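/- Let $A:\mathbb R\to\mathbb R$ be infinitely differentiable and such that $A$ and all its derivatives $A^{(p)}$ vanish exponentially fast towards $+\infty$ (for every $p\in\mathbb N$ there is $c>0$ with $A^{(p)}(x)=O(e^{-cx})$ as $x\to+\infty$). For $s\in\mathbb R$ let $A_s$ be the integral operator on $L^2(\mathbb R_+)$ with kernel $A_s(x,y)=A(x+y+s)$, let $K_s=A_s^2$, that is, the operator with kernel $K_s(x,y)=\int_0^\infty A(x+r+s)A(y+r+s)\,dr$, and let $A_s^{(p)}$ be the $p$-th derivative of $A_s$ in $s$, with kernel $A^{(p)}(x+y+s)$. For $p\in\mathbb N=\{0,1,2,\dots\}$ and $s$ such that $I-K_s$ is invertible on $L^2(\mathbb R_+)$, define $$q_p(s)=\langle\delta|A_s^{(p)}(I-K_s)^{-1}|\delta\rangle,\qquad u_p(s)=\langle\delta|A_s(I-K_s)^{-1}A_s^{(p)}|\delta\rangle,$$ where $\delta$ is the Dirac mass at $0$; explicitly, with $a_p(y)=A^{(p)}(y+s)$, $$q_p(s)=A^{(p)}(s)+\big\langle a_p,(I-K_s)^{-1}A_s a_0\big\rangle_{L^2(\mathbb R_+)},\qquad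 u_p(s)=\big\langle a_0,(I-K_s)^{-1}a_p\big\rangle_{L^2(\mathbb R_+)}.$$ 1. Suppose that $A$ satisfies the orthogonality relation $\int_{\mathbb R}A(x+r)A(r+y)\,dr=\delta(x-y)$ in the sense of distributions (tested against $\varphi(x)\psi(y)$ with $\varphi,\psi\in C_c^\infty(\mathbb R)$), and that $A$ extends to a holomorphic function $F$ on a strip $\{|\mathrm{Im}\,z|<\varepsilon\}$ with $|F(z)|\le Ce^{-c\,\mathrm{Re}\,z}$ for $\mathrm{Re}\,z\ge0$, for some $\varepsilon,c>0$ and some $C$. Then $I-K_s$ is invertible on $L^2(\mathbb R_+)$ for every $s\in\mathbb R$, so that $q_p$ and $u_p$ are defined on all of $\mathbb R$. 2. At every $s\in\mathbb R$ for which $I-K_s$ is invertible, and for every $p\in\mathbb N$, the functions $q_p$ and $u_p$ are differentiable at $s$ and $$q_p'(s)=q_{p+1}(s)-q_0(s)\,u_p(s),\qquad u_p'(s)=-q_0(s)\,q_p(s).$$ -/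

import Mathlib

open MeasureTheory Filter Asymptotics
open scoped ContDiff

namespace HankelHierarchy

noncomputable section

/-- Lebesgue measure on the half-line `ℝ₊ = (0, ∞)`. -/
abbrev halfLine : Measure ℝ := volume.restrict (Set.Ioi (0 : ℝ))

/-- The real Hilbert space `L²(ℝ₊)`. -/
abbrev L2 : Type := Lp ℝ 2 halfLine

/-- The bounded operator `T` on `L²(ℝ₊)` is the integral operator with kernel `k`. -/
def HasKernel (k : ℝ → ℝ → ℝ) (T : L2 →L[ℝ] L2) : Prop :=
  ∀ f : L2, ∀ᵐ x ∂halfLine,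
    Integrable (fun y => k x y * f y) halfLine ∧ T f x = ∫ y, k x y * f y ∂halfLine

theorem HasKernel.unique {k : ℝ → ℝ → ℝ} {T T' : L2 →L[ℝ] L2}
    (h : HasKernel k T) (h' : HasKernel k T') : T = T' := by
  ext1 f
  apply Lp.ext
  filter_upwards [h f, h' f] with x hx hx'
  rw [hx.2, hx'.2]

open Classical in
/-- The bounded integral operator on `L²(ℝ₊)` with kernel `k` (the zero operator if `k` is not
the kernel of a bounded operator). -/
def integralOp (k : ℝ → ℝ → ℝ) : L2 →L[ℝ] L2 :=
  if h : ∃ T, HasKernel k T then h.choose else 0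

theorem HasKernel.integralOp_eq {k : ℝ → ℝ → ℝ} {T : L2 →L[ℝ] L2} (h : HasKernel k T) :
    integralOp k = T := by
  have h' : ∃ T, HasKernel k T := ⟨T, h⟩
  rw [integralOp, dif_pos h']
  exact h'.choose_spec.unique h

open Classical in
/-- The element of `L²(ℝ₊)` given by a square-integrable function (zero for other functions). -/
def toL2 (f : ℝ → ℝ) : L2 :=
  if h : MemLp f 2 halfLine then h.toLp f else 0

/-- `f` vanishes exponentially fast towards `+∞`. -/
def ExpDecay (f : ℝ → ℝ) : Prop :=
  ∃ c : ℝ, 0 < c ∧ f =O[atTop] fun x => Real.exp (-c * x)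

/-- The operator `A_s` on `L²(ℝ₊)`, with kernel `A_s(x, y) = A(x + y + s)`. -/
def opA (A : ℝ → ℝ) (s : ℝ) : L2 →L[ℝ] L2 :=
  integralOp fun x y => A (x + y + s)

/-- For continuous, exponentially decaying `A`, the kernel `A(x + y + s)` is the kernel of a bounded
operator on `L²(ℝ₊)`, so that `integralOp` is not the default value. -/
theorem exists_hasKernel {A : ℝ → ℝ} (hc : Continuous A) (hd : ExpDecay A) (s : ℝ) :
    ∃ T, HasKernel (fun x y => A (x + y + s)) T := by
  obtain ⟨c, hc0, hO⟩ := hd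
  obtain ⟨C, hC0, hC⟩ : ∃ C, 0 ≤ C ∧ ∀ t, 0 ≤ t → |A (t + s)| ≤ C * Real.exp (-c * t) := by
    obtain ⟨C₁, hC₁⟩ := hO.bound
    obtain ⟨N, hN⟩ := eventually_atTop.1 hC₁
    have hcont : Continuous fun t => A (t + s) * Real.exp (c * t) := by fun_prop
    obtain ⟨M, hM⟩ := (isCompact_Icc (a := (0:ℝ)) (b := max 0 (N - s))).exists_bound_of_continuousOn
      hcont.continuousOn
    refine ⟨max 0 (max M (C₁ * Real.exp (-c * s))), le_max_left _ _, fun t ht => ?_⟩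
    rcases le_or_gt t (N - s) with h | h
    · have := hM t ⟨ht, h.trans (le_max_right _ _)⟩
      rw [norm_mul, Real.norm_eq_abs, Real.norm_of_nonneg (Real.exp_pos _).le] at this
      have h2 : |A (t + s)| ≤ M * Real.exp (-c * t) := by
        have := mul_le_mul_of_nonneg_right this (Real.exp_pos (-c * t)).le
        rwa [mul_assoc, ← Real.exp_add, show c * t + -c * t = 0 by ring, Real.exp_zero,
          mul_one] at this
      exact h2.trans (by gcongr; exact (le_max_left _ _).trans (le_max_right _ _))
    · have := hN (t + s) (by linarith)
      rw [Real.norm_eq_abs, Real.norm_of_nonneg (Real.exp_pos _).le,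
        show -c * (t + s) = -c * s + -c * t by ring, Real.exp_add, ← mul_assoc] at this
      exact this.trans (by gcongr; exact (le_max_right _ _).trans (le_max_right _ _))
  have hE : MemLp (fun y : ℝ => Real.exp (-c * y)) 2 halfLine := by
    rw [memLp_two_iff_integrable_sq (by fun_prop)]
    have : (fun y : ℝ => Real.exp (-c * y) ^ 2) = fun y => Real.exp (-(2 * c) * y) := by
      ext y; rw [← Real.exp_nat_mul]; congr 1; push_cast; ring
    rw [this]
    exact integrableOn_exp_mul_Ioi (by linarith) 0
  have hk : ∀ x, 0 < x → MemLp (fun y => A (x + y + s)) 2 halfLine := by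
    intro x hx
    refine hE.of_le_mul (c := C) (by fun_prop) ?_
    filter_upwards [ae_restrict_mem measurableSet_Ioi] with y hy
    have hy : 0 < y := hy
    rw [Real.norm_eq_abs, Real.norm_of_nonneg (Real.exp_pos _).le]
    refine (hC (x + y) (by positivity)).trans ?_
    exact mul_le_mul_of_nonneg_left (Real.exp_le_exp.2 (by nlinarith)) hC0
  have hint : ∀ x, 0 < x → ∀ f : L2, Integrable (fun y => A (x + y + s) * f y) halfLine :=
    fun x hx f => (hk x hx).integrable_mul (Lp.memLp f)
  have hb : ∀ f : L2, ∀ x, 0 < x → ‖∫ y, A (x + y + s) * f y ∂halfLine‖ ≤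
      (C * ‖hE.toLp _‖ * ‖f‖) * ‖Real.exp (-c * x)‖ := by
    intro f x hx
    have h1 : Integrable (fun y => Real.exp (-c * y) * |f y|) halfLine :=
      hE.integrable_mul (Lp.memLp f).abs
    have h2 : ∫ y, Real.exp (-c * y) * |f y| ∂halfLine ≤ ‖hE.toLp _‖ * ‖f‖ := by
      have : ∫ y, Real.exp (-c * y) * |f y| ∂halfLine = inner ℝ (hE.toLp _) |f| := by
        rw [L2.inner_def]
        refine integral_congr_ae ?_
        filter_upwards [hE.coeFn_toLp, Lp.coeFn_abs f] with y h1 h2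
        rw [h1, h2]; simp [mul_comm]
      rw [this]
      exact (real_inner_le_norm (hE.toLp _) |f|).trans_eq (by rw [norm_abs_eq_norm])
    have h3 : ‖∫ y, A (x + y + s) * f y ∂halfLine‖ ≤
        ∫ y, (C * Real.exp (-c * x)) * (Real.exp (-c * y) * |f y|) ∂halfLine := by
      refine norm_integral_le_of_norm_le (h1.const_mul _) ?_
      filter_upwards [ae_restrict_mem measurableSet_Ioi] with y hy
      have hy : 0 < y := hy
      rw [norm_mul, Real.norm_eq_abs, Real.norm_eq_abs, ← mul_assoc]
      gcongr
      refine (hC (x + y) (by positivity)).trans (le_of_eq ?_)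
      rw [mul_add, Real.exp_add, mul_assoc]
    rw [integral_const_mul] at h3
    refine h3.trans ?_
    rw [Real.norm_of_nonneg (Real.exp_pos _).le]
    have := mul_le_mul_of_nonneg_left h2 (mul_nonneg hC0 (Real.exp_pos (-c * x)).le)
    linarith
  have hmem : ∀ f : L2, MemLp (fun x => ∫ y, A (x + y + s) * f y ∂halfLine) 2 halfLine := by
    intro f
    refine hE.of_le_mul (c := C * ‖hE.toLp _‖ * ‖f‖) ?_ ?_
    · have : StronglyMeasurable (Function.uncurry fun x y => A (x + y + s) * f y) := by
        refine StronglyMeasurable.mul ?_ ((Lp.stronglyMeasurable f).comp_measurable measurable_snd)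
        exact Continuous.stronglyMeasurable (by fun_prop)
      exact this.integral_prod_right.aestronglyMeasurable
    · filter_upwards [ae_restrict_mem measurableSet_Ioi] with x hx
      exact hb f x hx
  let L : L2 →ₗ[ℝ] L2 :=
    { toFun := fun f => (hmem f).toLp _
      map_add' := fun f g => by
        rw [← MemLp.toLp_add]
        refine MemLp.toLp_congr _ _ ?_
        filter_upwards [ae_restrict_mem measurableSet_Ioi] with x hx
        rw [Pi.add_apply, ← integral_add (hint x hx f) (hint x hx g)]
        refine integral_congr_ae ?_
        filter_upwards [Lp.coeFn_add f g] with y hy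
        rw [hy, Pi.add_apply, mul_add]
      map_smul' := fun r f => by
        rw [RingHom.id_apply, ← MemLp.toLp_const_smul]
        refine MemLp.toLp_congr _ _ ?_
        filter_upwards with x
        rw [Pi.smul_apply, smul_eq_mul, ← integral_const_mul]
        refine integral_congr_ae ?_
        filter_upwards [Lp.coeFn_smul r f] with y hy
        rw [hy, Pi.smul_apply, smul_eq_mul]; ring }
  refine ⟨L.mkContinuous (C * ‖hE.toLp _‖ * ‖hE.toLp _‖) fun f => ?_, fun f => ?_⟩
  · have : ‖L f‖ ≤ (C * ‖hE.toLp _‖ * ‖f‖) * ‖hE.toLp _‖ := by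
      refine Lp.norm_le_mul_norm_of_ae_le_mul ?_
      filter_upwards [(hmem f).coeFn_toLp, hE.coeFn_toLp, ae_restrict_mem measurableSet_Ioi]
        with x h1 h2 hx
      rw [h2]
      change ‖(hmem f).toLp _ x‖ ≤ _
      rw [h1]
      exact hb f x hx
    linarith
  · filter_upwards [(hmem f).coeFn_toLp, ae_restrict_mem measurableSet_Ioi] with x h1 hx
    exact ⟨hint x hx f, h1⟩

theorem opA_hasKernel {A : ℝ → ℝ} (hc : Continuous A) (hd : ExpDecay A) (s : ℝ) :
    HasKernel (fun x y => A (x + y + s)) (opA A s) := by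
  obtain ⟨T, hT⟩ := exists_hasKernel hc hd s
  rw [opA, hT.integralOp_eq]
  exact hT

/-- The operator `K_s = A_s²`. -/
def opK (A : ℝ → ℝ) (s : ℝ) : L2 →L[ℝ] L2 :=
  opA A s ^ 2

/-- The operator `(I - K_s)⁻¹`, meaningful whenever `I - K_s` is invertible. -/
def res (A : ℝ → ℝ) (s : ℝ) : L2 →L[ℝ] L2 :=
  Ring.inverse (1 - opK A s)

/-- `A_s^{(p)}|δ⟩`, the function `x ↦ A_s^{(p)}(x, 0) = A^{(p)}(x + s)`; by symmetry of the kernel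
it also represents `⟨δ|A_s^{(p)}`. -/
def vecA (A : ℝ → ℝ) (p : ℕ) (s : ℝ) : L2 :=
  toL2 fun x => iteratedDeriv p A (x + s)

/-- `q_p(s) = ⟨δ|A_s^{(p)} (I - K_s)⁻¹|δ⟩`. Since `(I - K_s)⁻¹ = I + (I - K_s)⁻¹ K_s` and
`K_s|δ⟩ = A_s (A_s|δ⟩)`, the ket `(I - K_s)⁻¹|δ⟩` is the sum of the point mass at `0` and of the
element `(I - K_s)⁻¹ A_s (A_s|δ⟩)` of `L²(ℝ₊)`; it is paired with the function
`⟨δ|A_s^{(p)} : y ↦ A^{(p)}(y + s)`. -/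
def q (A : ℝ → ℝ) (p : ℕ) (s : ℝ) : ℝ :=
  iteratedDeriv p A s + inner ℝ (vecA A p s) (res A s (opA A s (vecA A 0 s)))

/-- `u_p(s) = ⟨δ|A_s (I - K_s)⁻¹ A_s^{(p)}|δ⟩`. -/
def u (A : ℝ → ℝ) (p : ℕ) (s : ℝ) : ℝ :=
  inner ℝ (vecA A 0 s) (res A s (vecA A p s))

/-- The orthogonality relation `∫_ℝ A(x + r) A(r + y) dr = δ(x - y)` in the sense of
distributions, that is, tested against `φ(x) ψ(y)`. -/
def Orthogonality (A : ℝ → ℝ) : Prop :=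
  ∀ φ ψ : ℝ → ℝ, ContDiff ℝ ∞ φ → HasCompactSupport φ → ContDiff ℝ ∞ ψ → HasCompactSupport ψ →
    Integrable (fun r => (∫ x, A (x + r) * φ x) * (∫ y, A (r + y) * ψ y)) ∧
    ∫ r, (∫ x, A (x + r) * φ x) * (∫ y, A (r + y) * ψ y) = ∫ x, φ x * ψ x

/-- `A` extends to a holomorphic function on a strip around the real axis which vanishes
exponentially fast towards `+∞`, uniformly in the strip. -/
def AnalyticInStrip (A : ℝ → ℝ) : Prop :=
  ∃ (F : ℂ → ℂ) (ε c C : ℝ), 0 < ε ∧ 0 < c ∧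
    DifferentiableOn ℂ F {z | |z.im| < ε} ∧
    (∀ x : ℝ, F x = A x) ∧
    ∀ z : ℂ, |z.im| < ε → 0 ≤ z.re → ‖F z‖ ≤ C * Real.exp (-c * z.re)

end

end HankelHierarchy

/-!
Integration by parts shows that `K_s` decreases in `s` with a rank-one derivative:
`K_s' = A_s A_s' + A_s' A_s = -|a_s⟩⟨a_s|`, where `a_s(x) = A(x + s)`.

For the hierarchy, put `R = (I - K_s)⁻¹`. Then `R' = -|R a_s⟩⟨R a_s|`, and the ring identity
`R (T B + B T) R - R T (T B + B T) T R = R T B + B T R`, with `T = A_s` and `B = A_s'`, expresses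
the operator `R T B + B T R` occurring in `u_p'` as a difference of two rank-one operators.

For the invertibility, orthogonality makes every `A_t` a contraction. If `K_s f = f`, then the
nonincreasing function `t ↦ ‖A_t f‖²`, whose derivative is `-⟨f, a_t⟩²`, is equal to its maximum
`‖f‖²` on `(-∞, s]`; hence `⟨f, a_t⟩` vanishes for `t < s`, for all `t` by analyticity, and
`f = A_s (A_s f) = 0`. Since `K_s` is compact, the Fredholm alternative applies.
-/

namespace HankelHierarchy

open InnerProductSpace (rankOne)
open scoped Topology

noncomputable section

section Lp

open scoped ENNReal

variable {α E : Type*} [MeasurableSpace α] {μ : Measure α} [NormedAddCommGroup E]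
  {p : ℝ≥0∞} [Fact (1 ≤ p)] {bound : α → ℝ}

theorem tendsto_toLp_of_dominated {ι : Type*} {l : Filter ι} [l.IsCountablyGenerated]
    {F : ι → α → E} {f : α → E} (hp : p ≠ ⊤) (hF : ∀ i, MemLp (F i) p μ) (hf : MemLp f p μ)
    (hbound : MemLp bound p μ) (h_bound : ∀ᶠ i in l, ∀ᵐ a ∂μ, ‖F i a‖ ≤ bound a)
    (h_lim : ∀ᵐ a ∂μ, Tendsto (F · a) l (𝓝 (f a))) :
    Tendsto (fun i => (hF i).toLp (F i)) l (𝓝 (hf.toLp f)) := by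
  have hp₀ : p ≠ 0 := (one_pos.trans_le (Fact.out : 1 ≤ p)).ne'
  have hp_pos : 0 < p.toReal := ENNReal.toReal_pos hp₀ hp
  have hsum : MemLp (fun a => bound a + ‖f a‖) p μ := hbound.add hf.norm
  suffices h : Tendsto (fun i => ∫⁻ a, ‖F i a - f a‖ₑ ^ p.toReal ∂μ) l
      (𝓝 (∫⁻ _, 0 ∂μ)) by
    rw [Lp.tendsto_Lp_iff_tendsto_eLpNorm'']
    simp only [eLpNorm_eq_lintegral_rpow_enorm_toReal hp₀ hp, Pi.sub_apply]
    simpa [hp_pos] using h.ennrpow_const (1 / p.toReal)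
  refine tendsto_lintegral_filter_of_dominated_convergence'
    (fun a => ‖bound a + ‖f a‖‖ₑ ^ p.toReal) ?_ ?_ ?_ ?_
  · exact Eventually.of_forall fun i => ((hF i).1.sub hf.1).enorm.pow_const _
  · filter_upwards [h_bound] with i hi
    filter_upwards [hi] with a ha
    gcongr
    rw [enorm_le_iff_norm_le]
    exact (norm_sub_le _ _).trans ((add_le_add_left ha _).trans (le_abs_self _))
  · exact (lintegral_rpow_enorm_lt_top_of_eLpNorm_lt_top hp₀ hp hsum.2).ne
  · filter_upwards [h_lim] with a ha
    have h := ((ha.sub_const (f a)).enorm).ennrpow_const p.toReal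
    simpa [hp_pos] using h

theorem hasDerivAt_toLp_of_dominated_loc_of_lip {𝕜 : Type*} [RCLike 𝕜] [NormedSpace 𝕜 E]
    {F : 𝕜 → α → E} {F' : α → E} {x₀ : 𝕜} {s : Set 𝕜} (hp : p ≠ ⊤) (hs : s ∈ 𝓝 x₀)
    (hF : ∀ x, MemLp (F x) p μ) (hF' : MemLp F' p μ) (hbound : MemLp bound p μ)
    (h_lipsch : ∀ᵐ a ∂μ, LipschitzOnWith (Real.nnabs (bound a)) (F · a) s)
    (h_diff : ∀ᵐ a ∂μ, HasDerivAt (F · a) (F' a) x₀) :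
    HasDerivAt (fun x => (hF x).toLp (F x)) (hF'.toLp F') x₀ := by
  rw [hasDerivAt_iff_tendsto_slope]
  have hslope (x : 𝕜) : MemLp (fun a => slope (F · a) x₀ x) p μ :=
    ((hF x).sub (hF x₀)).const_smul (x - x₀)⁻¹
  have heq (x : 𝕜) : slope (fun x => (hF x).toLp (F x)) x₀ x = (hslope x).toLp _ := by
    rw [slope_def_module, ← MemLp.toLp_sub, ← MemLp.toLp_const_smul]
    rfl
  rw [funext heq]
  refine tendsto_toLp_of_dominated hp hslope hF' hbound.norm ?_
    (h_diff.mono fun a ha => hasDerivAt_iff_tendsto_slope.1 ha)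
  filter_upwards [nhdsWithin_le_nhds hs, self_mem_nhdsWithin] with x hx hne
  filter_upwards [h_lipsch] with a ha
  rw [slope_def_module, norm_smul, norm_inv, inv_mul_le_iff₀ (norm_pos_iff.2 (sub_ne_zero.2 hne)),
    mul_comm]
  simpa using ha.norm_sub_le hx (mem_of_mem_nhds hs)

end Lp

theorem memLp_two_mul_prod {α β : Type*} [MeasurableSpace α] [MeasurableSpace β] {μ : Measure α}
    {ν : Measure β} [SFinite ν] {f : α → ℝ} {g : β → ℝ} (hf : MemLp f 2 μ) (hg : MemLp g 2 ν) :
    MemLp (fun z : α × β => f z.1 * g z.2) 2 (μ.prod ν) := by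
  refine (memLp_two_iff_integrable_sq (hf.1.comp_fst.mul hg.1.comp_snd)).2 ?_
  simpa only [Pi.mul_apply, mul_pow] using hf.integrable_sq.mul_prod hg.integrable_sq

section Decaying

variable {E F : Type*} [NormedAddCommGroup E] [NormedAddCommGroup F]

theorem ExpDecay.norm {f : ℝ → ℝ} (hf : ExpDecay f) : ExpDecay fun x => ‖f x‖ :=
  let ⟨c, hc, hO⟩ := hf
  ⟨c, hc, hO.norm_left⟩

/-- A continuous curve in `E` which vanishes exponentially fast towards `+∞`: the regularity under
which all translates of `v` are square integrable on the half-line. -/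
structure IsDecaying (v : ℝ → E) : Prop where
  continuous : Continuous v
  expDecay : ExpDecay fun x => ‖v x‖

/-- A continuously differentiable curve in `E` which vanishes exponentially fast towards `+∞`
together with its derivative. -/
structure IsDecayingC1 [NormedSpace ℝ E] (v : ℝ → E) : Prop where
  differentiable : Differentiable ℝ v
  expDecay : ExpDecay fun x => ‖v x‖
  isDecaying_deriv : IsDecaying (deriv v)

open Classical in
/-- The translate `x ↦ v (x + s)` as an element of `L²(ℝ₊; E)` (zero if it is not square
integrable). For `v = A⁽ᵖ⁾` it is `vecA A p s`, by definition. -/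
def translate (v : ℝ → E) (s : ℝ) : Lp E 2 halfLine :=
  if h : MemLp (fun x => v (x + s)) 2 halfLine then h.toLp _ else 0

theorem memLp_exp_neg_mul {c : ℝ} (hc : 0 < c) :
    MemLp (fun x : ℝ => Real.exp (-c * x)) 2 halfLine := by
  refine (memLp_two_iff_integrable_sq (by fun_prop)).2 ?_
  refine (integrableOn_exp_mul_Ioi (a := -(2 * c)) (by linarith) 0).congr
    (Eventually.of_forall fun x => ?_)
  simp only [← Real.exp_nat_mul]
  ring_nf

theorem exists_memLp_exp_neg_mul_le {c C : ℝ} (hc : 0 < c) (hC : 0 ≤ C) (a : ℝ) :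
    ∃ bound : ℝ → ℝ, MemLp bound 2 halfLine ∧
      ∀ x, ∀ t ≥ a, C * Real.exp (-c * (x + t)) ≤ bound x := by
  refine ⟨fun x => C * Real.exp (-c * a) * Real.exp (-c * x),
    (memLp_exp_neg_mul hc).const_mul _, fun x t ht => ?_⟩
  calc C * Real.exp (-c * (x + t)) ≤ C * Real.exp (-c * a + -c * x) := by gcongr; nlinarith
    _ = C * Real.exp (-c * a) * Real.exp (-c * x) := by rw [Real.exp_add, mul_assoc]

namespace IsDecaying

variable {v : ℝ → E}

theorem exists_norm_le (hv : IsDecaying v) (a : ℝ) :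
    ∃ c C : ℝ, 0 < c ∧ 0 ≤ C ∧ ∀ t ≥ a, ‖v t‖ ≤ C * Real.exp (-c * t) := by
  obtain ⟨c, hc, hO⟩ := hv.expDecay
  obtain ⟨N, hN⟩ := mem_atTop_sets.1 (isBigO_norm_left.1 hO).bound.choose_spec
  have h_far : v =O[𝓟 (Set.Ici N)] fun x => Real.exp (-c * x) :=
    isBigO_principal.2 ⟨_, fun t ht => hN t ht⟩
  have h_near : v =O[𝓟 (Set.Icc a N)] fun x => Real.exp (-c * x) :=
    (hv.continuous.continuousOn.isBigO_principal (c := (1 : ℝ)) isCompact_Icc (by simp)).trans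
      (ContinuousOn.isBigO_rev_principal (by fun_prop) isCompact_Icc
        (fun t _ => (Real.exp_pos _).ne') 1)
  have h_all : v =O[𝓟 (Set.Ici a)] fun x => Real.exp (-c * x) := by
    refine (h_near.sup h_far).mono ?_
    rw [sup_principal, principal_mono]
    exact fun t ht => (le_total t N).imp (fun h => ⟨ht, h⟩) id
  obtain ⟨C, hC₀, hC⟩ := h_all.exists_nonneg
  exact ⟨c, C, hc, hC₀, fun t ht => by simpa using isBigOWith_principal.1 hC t ht⟩

theorem exists_memLp_norm_translate_le (hv : IsDecaying v) (a : ℝ) :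
    ∃ bound : ℝ → ℝ, MemLp bound 2 halfLine ∧
      ∀ᵐ x ∂halfLine, ∀ t ≥ a, ‖v (x + t)‖ ≤ bound x := by
  obtain ⟨c, C, hc, hC₀, hC⟩ := hv.exists_norm_le a
  obtain ⟨bound, hbound, hle⟩ := exists_memLp_exp_neg_mul_le hc hC₀ a
  refine ⟨bound, hbound, ?_⟩
  filter_upwards [ae_restrict_mem measurableSet_Ioi] with x (hx : 0 < x) t ht
  exact (hC _ (by linarith)).trans (hle x t ht)

theorem memLp (hv : IsDecaying v) (s : ℝ) : MemLp (fun x => v (x + s)) 2 halfLine := by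
  obtain ⟨bound, hbound, hle⟩ := hv.exists_memLp_norm_translate_le s
  have := hv.continuous
  exact hbound.mono' (by fun_prop) (hle.mono fun x hx => hx s le_rfl)

theorem translate_eq_toLp (hv : IsDecaying v) (s : ℝ) : translate v s = (hv.memLp s).toLp _ :=
  dif_pos (hv.memLp s)

theorem coeFn_translate (hv : IsDecaying v) (s : ℝ) :
    translate v s =ᵐ[halfLine] fun x => v (x + s) := by
  rw [hv.translate_eq_toLp]
  exact (hv.memLp s).coeFn_toLp

theorem continuous_translate (hv : IsDecaying v) : Continuous (translate v) := by
  rw [funext hv.translate_eq_toLp, continuous_iff_continuousAt]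
  intro s
  obtain ⟨bound, hbound, hle⟩ := hv.exists_memLp_norm_translate_le (s - 1)
  refine tendsto_toLp_of_dominated (by simp) hv.memLp (hv.memLp s) hbound ?_
    (Eventually.of_forall fun x => (hv.continuous.comp (continuous_const_add x)).tendsto s)
  filter_upwards [Ioi_mem_nhds (sub_one_lt s)] with t ht
  exact hle.mono fun x hx => hx t (le_of_lt ht)

protected theorem translate (hv : IsDecaying v) : IsDecaying (translate v) where
  continuous := hv.continuous_translate
  expDecay := by
    obtain ⟨c, C, hc, -, hC⟩ := hv.exists_norm_le 0
    refine ⟨c, hc, IsBigO.of_bound (C * ‖(memLp_exp_neg_mul hc).toLp _‖) ?_⟩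
    filter_upwards [eventually_ge_atTop 0] with t ht
    rw [norm_norm, Real.norm_eq_abs, Real.abs_exp, mul_right_comm]
    refine Lp.norm_le_mul_norm_of_ae_le_mul ?_
    filter_upwards [hv.coeFn_translate t, (memLp_exp_neg_mul hc).coeFn_toLp,
      ae_restrict_mem measurableSet_Ioi] with x h₁ h₂ (hx : 0 < x)
    rw [h₁, h₂, Real.norm_eq_abs, Real.abs_exp, mul_assoc, ← Real.exp_add, ← mul_add, add_comm t]
    exact hC _ (by linarith)

theorem clm_comp [NormedSpace ℝ E] [NormedSpace ℝ F] (hv : IsDecaying v) (L : E →L[ℝ] F) :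
    IsDecaying fun t => L (v t) where
  continuous := L.continuous.comp hv.continuous
  expDecay := by
    obtain ⟨c, hc, hO⟩ := hv.expDecay
    exact ⟨c, hc, ((L.isBigO_comp v atTop).trans (isBigO_norm_left.1 hO)).norm_left⟩

end IsDecaying

namespace IsDecayingC1

variable [NormedSpace ℝ E] [NormedSpace ℝ F] {v : ℝ → E}

theorem isDecaying (hv : IsDecayingC1 v) : IsDecaying v :=
  ⟨hv.differentiable.continuous, hv.expDecay⟩

theorem hasDerivAt_translate (hv : IsDecayingC1 v) (s : ℝ) :
    HasDerivAt (translate v) (translate (deriv v) s) s := by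
  rw [funext hv.isDecaying.translate_eq_toLp, hv.isDecaying_deriv.translate_eq_toLp]
  obtain ⟨bound, hbound, hle⟩ := hv.isDecaying_deriv.exists_memLp_norm_translate_le (s - 1)
  have hderiv (x t : ℝ) : HasDerivAt (fun t => v (x + t)) (deriv v (x + t)) t :=
    (hv.differentiable _).hasDerivAt.comp_const_add x t
  refine hasDerivAt_toLp_of_dominated_loc_of_lip (by simp) (Ioi_mem_nhds (sub_one_lt s))
    hv.isDecaying.memLp (hv.isDecaying_deriv.memLp s) hbound ?_
    (Eventually.of_forall fun x => hderiv x s)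
  filter_upwards [hle] with x hx
  refine (convex_Ioi _).lipschitzOnWith_of_nnnorm_hasDerivWithin_le
    (fun t _ => (hderiv x t).hasDerivWithinAt) fun t ht => ?_
  rw [← NNReal.coe_le_coe, Real.coe_nnabs, coe_nnnorm]
  exact (hx t (le_of_lt ht)).trans (le_abs_self _)

theorem deriv_translate (hv : IsDecayingC1 v) :
    deriv (translate v) = translate (deriv v) :=
  funext fun s => (hv.hasDerivAt_translate s).deriv

protected theorem translate (hv : IsDecayingC1 v) : IsDecayingC1 (translate v) where
  differentiable s := (hv.hasDerivAt_translate s).differentiableAt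
  expDecay := hv.isDecaying.translate.expDecay
  isDecaying_deriv := hv.deriv_translate ▸ hv.isDecaying_deriv.translate

theorem deriv_clm_comp (hv : IsDecayingC1 v) (L : E →L[ℝ] F) :
    deriv (fun t => L (v t)) = fun t => L (deriv v t) :=
  funext fun t => (L.hasFDerivAt.comp_hasDerivAt t (hv.differentiable t).hasDerivAt).deriv

theorem clm_comp (hv : IsDecayingC1 v) (L : E →L[ℝ] F) : IsDecayingC1 fun t => L (v t) where
  differentiable := L.differentiable.comp hv.differentiable
  expDecay := (hv.isDecaying.clm_comp L).expDecay
  isDecaying_deriv := hv.deriv_clm_comp L ▸ hv.isDecaying_deriv.clm_comp L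

end IsDecayingC1

end Decaying

section HilbertSchmidt

variable {α H : Type*} [MeasurableSpace α] {μ : Measure α} [NormedAddCommGroup H]
  [InnerProductSpace ℝ H]

/-- The Hilbert–Schmidt operator `f ↦ (x ↦ ⟨f, V x⟩)` from `H` to `L²(μ)` defined by a square
integrable family `V` of vectors of `H`, as a continuous linear function of `V`. -/
def hsOp : Lp H 2 μ →L[ℝ] H →L[ℝ] Lp ℝ 2 μ :=
  ((innerSL ℝ).compLpL₂ 2 μ).flip

theorem coeFn_hsOp (V : Lp H 2 μ) (f : H) : hsOp V f =ᵐ[μ] fun x => inner ℝ f (V x) :=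
  (innerSL ℝ f).coeFn_compLp V

theorem hsOp_indicatorConst {S : Set α} (hS : MeasurableSet S) (hμS : μ S ≠ ⊤) (c : H) :
    hsOp (indicatorConstLp 2 hS hμS c) =
      InnerProductSpace.rankOne ℝ (indicatorConstLp 2 hS hμS (1 : ℝ)) c := by
  ext1 f
  refine Lp.ext ((coeFn_hsOp _ f).trans ?_)
  rw [InnerProductSpace.rankOne_apply]
  filter_upwards [Lp.coeFn_smul (inner ℝ c f) (indicatorConstLp 2 hS hμS (1 : ℝ)),
    indicatorConstLp_coeFn (p := 2) (hs := hS) (hμs := hμS) (c := c),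
    indicatorConstLp_coeFn (p := 2) (hs := hS) (hμs := hμS) (c := (1 : ℝ))] with x h₁ h₂ h₃
  rw [h₁, Pi.smul_apply, h₂, h₃]
  by_cases hx : x ∈ S <;> simp [hx, real_inner_comm]

theorem isCompactOperator_hsOp (V : Lp H 2 μ) : IsCompactOperator (hsOp V) := by
  refine Lp.induction (by simp) (motive := fun V => IsCompactOperator (hsOp V)) ?_ ?_ ?_ V
  · intro c S hS hμS
    rw [Lp.simpleFunc.coe_indicatorConst, hsOp_indicatorConst hS hμS.ne]
    exact (isCompactOperator_of_locallyCompactSpace_dom (innerSL ℝ c)).clm_comp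
      (ContinuousLinearMap.toSpanSingleton ℝ (indicatorConstLp 2 hS hμS.ne (1 : ℝ)))
  · intro f g hf hg _ h₁ h₂
    rw [map_add]
    exact h₁.add h₂
  · exact isClosed_setOfPred_isCompactOperator.preimage hsOp.continuous

end HilbertSchmidt

theorem inner_eq_integral_mul {α : Type*} [MeasurableSpace α] {μ : Measure α} (f g : Lp ℝ 2 μ) :
    inner ℝ f g = ∫ x, f x * g x ∂μ := by
  simp only [L2.inner_def, RCLike.inner_apply, conj_trivial, mul_comm]

theorem inner_translate {f g : ℝ → ℝ} (hf : IsDecaying f) (hg : IsDecaying g) (s t : ℝ) :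
    inner ℝ (translate f s) (translate g t) = ∫ x, f (x + s) * g (x + t) ∂halfLine := by
  rw [inner_eq_integral_mul]
  refine integral_congr_ae ?_
  filter_upwards [hf.coeFn_translate s, hg.coeFn_translate t] with x h₁ h₂
  rw [h₁, h₂]

/-- Square integrability justifies the exchange of the two integrals in `⟨T f, g⟩ = ⟨f, T g⟩`. -/
theorem HasKernel.isSelfAdjoint {k : ℝ → ℝ → ℝ} {T : L2 →L[ℝ] L2} (hT : HasKernel k T)
    (hk : MemLp (Function.uncurry k) 2 (halfLine.prod halfLine)) (hsymm : ∀ x y, k x y = k y x) :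
    IsSelfAdjoint T := by
  refine ContinuousLinearMap.isSelfAdjoint_iff_isSymmetric.2 fun f g => ?_
  have hint : Integrable (Function.uncurry fun x y => k x y * (f y * g x))
      (halfLine.prod halfLine) := by
    refine (hk.integrable_mul (memLp_two_mul_prod (Lp.memLp g) (Lp.memLp f))).congr
      (Eventually.of_forall fun z => ?_)
    simp only [Function.uncurry, Pi.mul_apply, mul_comm (f z.2)]
  calc inner ℝ (T f) g = ∫ x, ∫ y, k x y * (f y * g x) ∂halfLine ∂halfLine := by
        rw [inner_eq_integral_mul]
        refine integral_congr_ae ((hT f).mono fun x hx => ?_)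
        simp only [hx.2, ← integral_mul_const, mul_assoc]
    _ = ∫ y, ∫ x, k x y * (f y * g x) ∂halfLine ∂halfLine := integral_integral_swap hint
    _ = inner ℝ f (T g) := by
        rw [inner_eq_integral_mul]
        refine integral_congr_ae ((hT g).mono fun y hy => ?_)
        simp only [hy.2, ← integral_const_mul, hsymm y, mul_left_comm]

section Hankel

variable {B : ℝ → ℝ}

namespace IsDecaying

theorem hasKernel_opA (hB : IsDecaying B) (s : ℝ) :
    HasKernel (fun x y => B (x + y + s)) (opA B s) := by
  obtain ⟨c, hc, hO⟩ := hB.expDecay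
  exact opA_hasKernel hB.continuous ⟨c, hc, isBigO_norm_left.1 hO⟩ s

theorem opA_eq_hsOp (hB : IsDecaying B) (s : ℝ) :
    opA B s = hsOp (translate (translate B) s) := by
  ext1 f
  apply Lp.ext
  filter_upwards [hB.hasKernel_opA s f, coeFn_hsOp (translate (translate B) s) f,
    hB.translate.coeFn_translate s] with x h₁ h₂ h₃
  rw [h₁.2, h₂, h₃, real_inner_comm, inner_eq_integral_mul]
  refine integral_congr_ae ((hB.coeFn_translate (x + s)).mono fun y hy => ?_)
  simp only [hy, add_left_comm y, add_assoc]

theorem isDecaying_inner_translate (hB : IsDecaying B) (f : L2) :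
    IsDecaying fun t => inner ℝ f (translate B t) :=
  hB.translate.clm_comp (innerSL ℝ f)

theorem opA_apply (hB : IsDecaying B) (s : ℝ) (f : L2) :
    opA B s f = translate (fun t => inner ℝ f (translate B t)) s := by
  apply Lp.ext
  rw [hB.opA_eq_hsOp]
  filter_upwards [coeFn_hsOp (translate (translate B) s) f, hB.translate.coeFn_translate s,
    (hB.isDecaying_inner_translate f).coeFn_translate s] with x h₁ h₂ h₃
  rw [h₁, h₂, h₃]

theorem isCompactOperator_opA (hB : IsDecaying B) (s : ℝ) : IsCompactOperator (opA B s) :=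
  hB.opA_eq_hsOp s ▸ isCompactOperator_hsOp _

theorem memLp_uncurry_add (hB : IsDecaying B) (s : ℝ) :
    MemLp (Function.uncurry fun x y => B (x + y + s)) 2 (halfLine.prod halfLine) := by
  obtain ⟨c, C, hc, -, hC⟩ := hB.exists_norm_le s
  have hexp := memLp_exp_neg_mul hc
  have := hB.continuous
  refine ((memLp_two_mul_prod hexp hexp).const_mul (C * Real.exp (-c * s))).mono'
    (Continuous.aestronglyMeasurable (by fun_prop)) ?_
  rw [Measure.prod_restrict]
  filter_upwards [ae_restrict_mem (measurableSet_Ioi.prod measurableSet_Ioi)] with z hz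
  have hz₁ : 0 < z.1 := hz.1
  have hz₂ : 0 < z.2 := hz.2
  refine (hC _ (by linarith)).trans_eq ?_
  rw [mul_assoc, ← Real.exp_add, ← Real.exp_add]
  ring_nf

theorem isSelfAdjoint_opA (hB : IsDecaying B) (s : ℝ) : IsSelfAdjoint (opA B s) :=
  (hB.hasKernel_opA s).isSelfAdjoint (hB.memLp_uncurry_add s) fun x y => by rw [add_comm x]

end IsDecaying

theorem IsDecayingC1.hasDerivAt_opA (hB : IsDecayingC1 B) (s : ℝ) :
    HasDerivAt (opA B) (opA (deriv B) s) s := by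
  rw [funext hB.isDecaying.opA_eq_hsOp, hB.isDecaying_deriv.opA_eq_hsOp, ← hB.deriv_translate]
  exact hsOp.hasFDerivAt.comp_hasDerivAt s (hB.translate.hasDerivAt_translate s)

end Hankel

section RankOneDerivative

namespace IsDecaying

variable {A : ℝ → ℝ}

theorem inner_opA_comm (hA : IsDecaying A) (s : ℝ) (f g : L2) :
    inner ℝ (opA A s f) g = inner ℝ f (opA A s g) :=
  (hA.isSelfAdjoint_opA s).isSymmetric f g

theorem isSelfAdjoint_res (hA : IsDecaying A) (s : ℝ) : IsSelfAdjoint (res A s) :=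
  ((IsSelfAdjoint.one _).sub ((hA.isSelfAdjoint_opA s).pow 2)).ringInverse

theorem inner_res_comm (hA : IsDecaying A) (s : ℝ) (f g : L2) :
    inner ℝ (res A s f) g = inner ℝ f (res A s g) :=
  (hA.isSelfAdjoint_res s).isSymmetric f g

end IsDecaying

namespace IsDecayingC1

theorem inner_translate_deriv_add {φ ψ : ℝ → ℝ} (hφ : IsDecayingC1 φ) (hψ : IsDecayingC1 ψ)
    (s t : ℝ) :
    inner ℝ (translate φ s) (translate (deriv ψ) t) +
      inner ℝ (translate (deriv φ) s) (translate ψ t) = -(φ s * ψ t) := by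
  rw [inner_translate hφ.isDecaying hψ.isDecaying_deriv,
    inner_translate hφ.isDecaying_deriv hψ.isDecaying]
  have mφ := hφ.isDecaying.memLp s
  have mψ := hψ.isDecaying.memLp t
  have mφ' := hφ.isDecaying_deriv.memLp s
  have mψ' := hψ.isDecaying_deriv.memLp t
  have hint := (mφ.integrable_mul mψ').add (mφ'.integrable_mul mψ)
  have hderiv (x : ℝ) : HasDerivAt (fun x => φ (x + s) * ψ (x + t))
      (φ (x + s) * deriv ψ (x + t) + deriv φ (x + s) * ψ (x + t)) x := by
    rw [add_comm]
    exact ((hφ.differentiable _).hasDerivAt.comp_add_const x s).mul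
      ((hψ.differentiable _).hasDerivAt.comp_add_const x t)
  have hzero := tendsto_zero_of_hasDerivAt_of_integrableOn_Ioi (a := 0) (fun x _ => hderiv x) hint
    (mφ.integrable_mul mψ)
  refine (integral_add (mφ.integrable_mul mψ') (mφ'.integrable_mul mψ)).symm.trans ?_
  simpa using integral_Ioi_of_hasDerivAt_of_tendsto' (fun x _ => hderiv x) hint hzero

variable {A D : ℝ → ℝ}

theorem isDecayingC1_inner_translate (hA : IsDecayingC1 A) (f : L2) :
    IsDecayingC1 fun t => inner ℝ f (translate A t) :=
  hA.translate.clm_comp (innerSL ℝ f)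

theorem opA_deriv_apply (hA : IsDecayingC1 A) (s : ℝ) (f : L2) :
    opA (deriv A) s f = translate (deriv fun t => inner ℝ f (translate A t)) s := by
  have h : deriv (fun t => inner ℝ f (translate A t)) =
      fun t => inner ℝ f (deriv (translate A) t) :=
    hA.translate.deriv_clm_comp (innerSL ℝ f)
  rw [h, hA.deriv_translate, hA.isDecaying_deriv.opA_apply]

theorem opA_translate_deriv_add (hA : IsDecayingC1 A) (hD : IsDecayingC1 D) (s : ℝ) :
    opA A s (translate (deriv D) s) + opA (deriv A) s (translate D s) =
      -(D s • translate A s) := by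
  refine ext_inner_right ℝ fun g => ?_
  rw [inner_add_left, hA.isDecaying.inner_opA_comm, hA.isDecaying_deriv.inner_opA_comm,
    hA.isDecaying.opA_apply, hA.opA_deriv_apply, add_comm,
    hD.inner_translate_deriv_add (hA.isDecayingC1_inner_translate g), inner_neg_left,
    real_inner_smul_left, real_inner_comm]

theorem inner_opA_opA_deriv_add (hA : IsDecayingC1 A) (s : ℝ) (f g : L2) :
    inner ℝ (opA A s f) (opA (deriv A) s g) + inner ℝ (opA (deriv A) s f) (opA A s g) =
      -(inner ℝ f (translate A s) * inner ℝ g (translate A s)) := by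
  simp only [hA.isDecaying.opA_apply, hA.opA_deriv_apply]
  exact (hA.isDecayingC1_inner_translate f).inner_translate_deriv_add
    (hA.isDecayingC1_inner_translate g) s s

theorem opA_mul_opA_deriv_add (hA : IsDecayingC1 A) (s : ℝ) :
    opA A s * opA (deriv A) s + opA (deriv A) s * opA A s =
      -rankOne ℝ (translate A s) (translate A s) := by
  ext1 f
  refine ext_inner_right ℝ fun g => ?_
  calc inner ℝ (opA A s (opA (deriv A) s f) + opA (deriv A) s (opA A s f)) g
      = inner ℝ (opA A s f) (opA (deriv A) s g) + inner ℝ (opA (deriv A) s f) (opA A s g) := by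
        rw [inner_add_left, hA.isDecaying.inner_opA_comm s (opA (deriv A) s f),
          hA.isDecaying_deriv.inner_opA_comm s (opA A s f), add_comm,
          ← hA.isDecaying.inner_opA_comm, ← hA.isDecaying_deriv.inner_opA_comm]
    _ = inner ℝ (-(inner ℝ (translate A s) f • translate A s)) g := by
        rw [hA.inner_opA_opA_deriv_add, inner_neg_left, real_inner_smul_left, real_inner_comm f,
          real_inner_comm g]

theorem hasDerivAt_opK (hA : IsDecayingC1 A) (s : ℝ) :
    HasDerivAt (opK A) (-rankOne ℝ (translate A s) (translate A s)) s := by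
  have hK : opK A = opA A * opA A := funext fun t => sq (opA A t)
  rw [hK, ← hA.opA_mul_opA_deriv_add, add_comm]
  exact (hA.hasDerivAt_opA s).mul (hA.hasDerivAt_opA s)

theorem hasDerivAt_res (hA : IsDecayingC1 A) {s : ℝ} (hs : IsUnit (1 - opK A s)) :
    HasDerivAt (res A)
      (-rankOne ℝ (res A s (translate A s)) (res A s (translate A s))) s := by
  obtain ⟨U, hU⟩ := hs
  have hinv := hasFDerivAt_ringInverse (𝕜 := ℝ) U
  have hres : (↑U⁻¹ : L2 →L[ℝ] L2) = res A s := by rw [res, ← hU, Ring.inverse_unit]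
  rw [hU, hres] at hinv
  refine (hinv.comp_hasDerivAt s ((hA.hasDerivAt_opK s).const_sub 1)).congr_deriv ?_
  have hadj := (hA.isDecaying.isSelfAdjoint_res s).adjoint_eq
  rw [neg_neg, neg_apply, ContinuousLinearMap.mulLeftRight_apply,
    ContinuousLinearMap.mul_def, ContinuousLinearMap.mul_def, InnerProductSpace.comp_rankOne,
    InnerProductSpace.rankOne_comp, hadj]

end IsDecayingC1

end RankOneDerivative

section Hierarchy

theorem resolvent_conj_sub_conj {R : Type*} [Ring R] {r t : R} (hl : r * (1 - t ^ 2) = 1)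
    (hr : (1 - t ^ 2) * r = 1) (b : R) :
    r * (t * b + b * t) * r - r * t * (t * b + b * t) * (t * r) = r * t * b + b * t * r := by
  calc _ = r * t * b * ((1 - t ^ 2) * r) + r * (1 - t ^ 2) * (b * t * r) := by noncomm_ring
    _ = r * t * b + b * t * r := by rw [hl, hr, mul_one, one_mul]

/-- The function `q_p` with an arbitrary `D` in place of `A⁽ᵖ⁾`. -/
def qWith (A D : ℝ → ℝ) (s : ℝ) : ℝ :=
  D s + inner ℝ (translate D s) (res A s (opA A s (translate A s)))

/-- The function `u_p` with an arbitrary `D` in place of `A⁽ᵖ⁾`. -/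
def uWith (A D : ℝ → ℝ) (s : ℝ) : ℝ :=
  inner ℝ (translate A s) (res A s (translate D s))

theorem q_eq_qWith (A : ℝ → ℝ) (p : ℕ) : q A p = qWith A (iteratedDeriv p A) := by
  funext s
  rw [q, vecA, vecA, iteratedDeriv_zero]
  rfl

theorem u_eq_uWith (A : ℝ → ℝ) (p : ℕ) : u A p = uWith A (iteratedDeriv p A) := by
  funext s
  rw [u, vecA, vecA, iteratedDeriv_zero]
  rfl

variable {A D : ℝ → ℝ} {s : ℝ}

theorem inner_res_opA_translate :
    inner ℝ (res A s (opA A s (translate A s))) (translate D s) = qWith A D s - D s := by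
  rw [real_inner_comm, qWith, add_sub_cancel_left]

theorem res_opA_apply (hs : IsUnit (1 - opK A s)) (f : L2) :
    res A s (opA A s f) = opA A s (res A s f) := by
  have h : Commute (1 - opK A s) (opA A s) :=
    (Commute.one_left _).sub_left ((Commute.refl (opA A s)).pow_left 2)
  obtain ⟨U, hU⟩ := hs
  rw [res, ← hU, Ring.inverse_unit]
  rw [← hU] at h
  exact DFunLike.congr_fun h.units_inv_left.eq f

theorem IsDecaying.inner_res (hA : IsDecaying A) (hs : IsUnit (1 - opK A s)) (f g : L2) :
    inner ℝ f (res A s g) = inner ℝ f g + inner ℝ (res A s (opA A s f)) (opA A s g) := by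
  have h : res A s * (1 - opA A s ^ 2) = 1 := Ring.inverse_mul_cancel _ hs
  have hg : res A s (g - opA A s (opA A s g)) = g := DFunLike.congr_fun h g
  rw [map_sub, sub_eq_iff_eq_add] at hg
  rw [hA.inner_res_comm, hA.inner_opA_comm, ← res_opA_apply hs, ← inner_add_right, ← hg]

theorem IsDecaying.inner_translate_res_opA (hA : IsDecaying A) (hs : IsUnit (1 - opK A s)) :
    inner ℝ (translate A s) (res A s (opA A s (translate D s))) = qWith A D s - D s := by
  rw [← inner_res_opA_translate, hA.inner_res_comm, hA.inner_opA_comm, res_opA_apply hs]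

namespace IsDecayingC1

theorem mul_opA_anticommutator_mul_adjoint (hA : IsDecayingC1 A) (s : ℝ) (S : L2 →L[ℝ] L2) :
    S * (opA A s * opA (deriv A) s + opA (deriv A) s * opA A s) * S.adjoint =
      -rankOne ℝ (S (translate A s)) (S (translate A s)) := by
  rw [hA.opA_mul_opA_deriv_add, mul_neg, neg_mul, ContinuousLinearMap.mul_def,
    ContinuousLinearMap.mul_def, InnerProductSpace.comp_rankOne, InnerProductSpace.rankOne_comp,
    ContinuousLinearMap.adjoint_adjoint]

theorem res_mul_opA_mul_opA_deriv_add (hA : IsDecayingC1 A) (hs : IsUnit (1 - opK A s)) :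
    res A s * opA A s * opA (deriv A) s + opA (deriv A) s * opA A s * res A s =
      rankOne ℝ (res A s (opA A s (translate A s))) (res A s (opA A s (translate A s))) -
        rankOne ℝ (res A s (translate A s)) (res A s (translate A s)) := by
  have hR : (res A s).adjoint = res A s := (hA.isDecaying.isSelfAdjoint_res s).adjoint_eq
  have hRT : (res A s * opA A s).adjoint = opA A s * res A s := by
    rw [ContinuousLinearMap.mul_def, ContinuousLinearMap.adjoint_comp, hR,
      (hA.isDecaying.isSelfAdjoint_opA s).adjoint_eq, ContinuousLinearMap.mul_def]
  have h₁ := hA.mul_opA_anticommutator_mul_adjoint s (res A s)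
  have h₂ := hA.mul_opA_anticommutator_mul_adjoint s (res A s * opA A s)
  rw [hR] at h₁
  rw [hRT, mul_apply_eq_comp] at h₂
  rw [← resolvent_conj_sub_conj (r := res A s) (Ring.inverse_mul_cancel _ hs)
    (Ring.mul_inverse_cancel _ hs), h₁, h₂, neg_sub_neg]

theorem inner_res_opA_opA_deriv_add (hA : IsDecayingC1 A) (hs : IsUnit (1 - opK A s))
    (f g : L2) :
    inner ℝ (res A s (opA A s f)) (opA (deriv A) s g) +
        inner ℝ (opA (deriv A) s f) (res A s (opA A s g)) =
      inner ℝ (res A s (opA A s (translate A s))) f *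
          inner ℝ (res A s (opA A s (translate A s))) g -
        inner ℝ (res A s (translate A s)) f * inner ℝ (res A s (translate A s)) g := by
  have h := congrArg (inner ℝ f) (DFunLike.congr_fun (hA.res_mul_opA_mul_opA_deriv_add hs) g)
  simp only [add_apply, sub_apply, mul_apply_eq_comp, InnerProductSpace.rankOne_apply,
    inner_add_right, inner_sub_right, real_inner_smul_right] at h
  rw [hA.isDecaying.inner_res_comm, hA.isDecaying.inner_opA_comm, ← res_opA_apply hs,
    hA.isDecaying_deriv.inner_opA_comm, res_opA_apply hs g, h, real_inner_comm f,
    real_inner_comm f]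
  ring

theorem hasDerivAt_qWith (hA : IsDecayingC1 A) (hD : IsDecayingC1 D) (hs : IsUnit (1 - opK A s)) :
    HasDerivAt (qWith A D) (qWith A (deriv D) s - qWith A A s * uWith A D s) s := by
  have hTa : HasDerivAt (fun t => opA A t (translate A t)) (-(A s • translate A s)) s := by
    rw [← hA.opA_translate_deriv_add hA, add_comm]
    exact (hA.hasDerivAt_opA s).clm_apply (hA.hasDerivAt_translate s)
  refine ((hD.differentiable s).hasDerivAt.add ((hD.hasDerivAt_translate s).inner ℝ
    ((hA.hasDerivAt_res hs).clm_apply hTa))).congr_deriv ?_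
  have hu : inner ℝ (translate D s) (res A s (translate A s)) = uWith A D s := by
    rw [real_inner_comm, hA.isDecaying.inner_res_comm, uWith]
  have hq : inner ℝ (res A s (translate A s)) (opA A s (translate A s)) = qWith A A s - A s := by
    rw [hA.isDecaying.inner_res_comm, qWith, add_sub_cancel_left]
  rw [inner_add_right, neg_apply, InnerProductSpace.rankOne_apply, map_neg, map_smul,
    inner_neg_right, inner_neg_right, real_inner_smul_right, real_inner_smul_right, hu, hq]
  simp only [qWith]
  ring

theorem inner_res_translate_deriv_add (hA : IsDecayingC1 A) (hD : IsDecayingC1 D)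
    (hs : IsUnit (1 - opK A s)) :
    inner ℝ (translate A s) (res A s (translate (deriv D) s)) +
        inner ℝ (translate (deriv A) s) (res A s (translate D s)) =
      uWith A A s * uWith A D s - qWith A A s * qWith A D s := by
  have hTa' : opA A s (translate (deriv A) s) =
      -(A s • translate A s) - opA (deriv A) s (translate A s) :=
    eq_sub_of_add_eq (hA.opA_translate_deriv_add hA s)
  have hTd' : opA A s (translate (deriv D) s) =
      -(D s • translate A s) - opA (deriv A) s (translate D s) :=
    eq_sub_of_add_eq (hA.opA_translate_deriv_add hD s)
  have hparts := hA.inner_translate_deriv_add hD s s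
  have hrank := hA.inner_res_opA_opA_deriv_add hs (translate A s) (translate D s)
  simp only [hA.isDecaying.inner_res_comm s (translate A s) (translate _ s)] at hrank
  rw [inner_res_opA_translate, inner_res_opA_translate] at hrank
  calc inner ℝ (translate A s) (res A s (translate (deriv D) s)) +
        inner ℝ (translate (deriv A) s) (res A s (translate D s))
      = inner ℝ (translate A s) (translate (deriv D) s) +
          inner ℝ (translate (deriv A) s) (translate D s) +
          inner ℝ (res A s (opA A s (translate A s))) (opA A s (translate (deriv D) s)) +
          inner ℝ (opA A s (translate (deriv A) s)) (res A s (opA A s (translate D s))) := by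
        rw [hA.isDecaying.inner_res hs, hA.isDecaying.inner_res hs (translate (deriv A) s),
          hA.isDecaying.inner_res_comm s (opA A s (translate (deriv A) s))]
        ring
    _ = uWith A A s * uWith A D s - qWith A A s * qWith A D s := by
        rw [hparts, hTa', hTd', inner_sub_right, inner_sub_left, inner_neg_right, inner_neg_left,
          real_inner_smul_right, real_inner_smul_left, inner_res_opA_translate,
          hA.isDecaying.inner_translate_res_opA hs]
        simp only [uWith]
        linarith

theorem hasDerivAt_uWith (hA : IsDecayingC1 A) (hD : IsDecayingC1 D) (hs : IsUnit (1 - opK A s)) :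
    HasDerivAt (uWith A D) (-(qWith A A s * qWith A D s)) s := by
  refine ((hA.hasDerivAt_translate s).inner ℝ
    ((hA.hasDerivAt_res hs).clm_apply (hD.hasDerivAt_translate s))).congr_deriv ?_
  rw [inner_add_right, add_assoc, hA.inner_res_translate_deriv_add hD hs, neg_apply,
    InnerProductSpace.rankOne_apply, inner_neg_right, real_inner_smul_right,
    hA.isDecaying.inner_res_comm, uWith, uWith]
  ring

end IsDecayingC1

end Hierarchy

section Strip

/-- `F` is holomorphic in the strip `|Im z| < ε` and vanishes exponentially fast towards `+∞`,
uniformly in the strip. Unlike in `AnalyticInStrip`, a bound is imposed on every right half of the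
strip, so that the derivative of `F` has the same property in a smaller strip. -/
structure DecaysInStrip (F : ℂ → ℂ) (ε : ℝ) : Prop where
  differentiableOn : DifferentiableOn ℂ F {z | |z.im| < ε}
  exists_norm_le : ∀ a : ℝ, ∃ c C : ℝ, 0 < c ∧ 0 ≤ C ∧
    ∀ z : ℂ, |z.im| < ε → a ≤ z.re → ‖F z‖ ≤ C * Real.exp (-c * z.re)

theorem isOpen_abs_im_lt (ε : ℝ) : IsOpen {z : ℂ | |z.im| < ε} :=
  isOpen_lt (by fun_prop) continuous_const

theorem AnalyticInStrip.exists_decaysInStrip {A : ℝ → ℝ} (hA : AnalyticInStrip A) :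
    ∃ F ε, 0 < ε ∧ DecaysInStrip F ε ∧ ∀ x : ℝ, F x = A x := by
  obtain ⟨F, ε, c, C, hε, hc, hF, hFA, hC⟩ := hA
  refine ⟨F, ε / 2, half_pos hε, ⟨hF.mono fun z (hz : |z.im| < ε / 2) => hz.trans (half_lt_self hε),
    fun a => ?_⟩, hFA⟩
  have h_far : F =O[𝓟 {z : ℂ | |z.im| < ε ∧ 0 ≤ z.re}] fun z => Real.exp (-c * z.re) :=
    isBigO_principal.2 ⟨C, fun z hz => by simpa using hC z hz.1 hz.2⟩
  have hK : IsCompact (Set.Icc a 0 ×ℂ Set.Icc (-(ε / 2)) (ε / 2)) :=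
    isCompact_Icc.reProdIm isCompact_Icc
  have hFK : ContinuousOn F (Set.Icc a 0 ×ℂ Set.Icc (-(ε / 2)) (ε / 2)) :=
    hF.continuousOn.mono fun z hz => (abs_le.2 hz.2).trans_lt (half_lt_self hε)
  have h_near : F =O[𝓟 (Set.Icc a 0 ×ℂ Set.Icc (-(ε / 2)) (ε / 2))]
      fun z => Real.exp (-c * z.re) :=
    (hFK.isBigO_principal (c := (1 : ℝ)) hK (by simp)).trans
      (ContinuousOn.isBigO_rev_principal (by fun_prop) hK (fun z _ => (Real.exp_pos _).ne') 1)
  have h_all : F =O[𝓟 {z : ℂ | |z.im| < ε / 2 ∧ a ≤ z.re}] fun z => Real.exp (-c * z.re) := by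
    refine (h_near.sup h_far).mono ?_
    rw [sup_principal, principal_mono]
    exact fun z hz => (le_total z.re 0).imp (fun h => ⟨⟨hz.2, h⟩, abs_le.1 hz.1.le⟩)
      fun h => ⟨hz.1.trans (half_lt_self hε), h⟩
  obtain ⟨M, hM₀, hM⟩ := h_all.exists_nonneg
  exact ⟨c, M, hc, hM₀, fun z hz ha => by simpa using isBigOWith_principal.1 hM z ⟨hz, ha⟩⟩

namespace DecaysInStrip

variable {F : ℂ → ℂ} {ε : ℝ}

theorem hasDerivAt (hF : DecaysInStrip F ε) {z : ℂ} (hz : |z.im| < ε) :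
    HasDerivAt F (deriv F z) z :=
  (hF.differentiableOn.differentiableAt ((isOpen_abs_im_lt ε).mem_nhds hz)).hasDerivAt

protected theorem deriv (hF : DecaysInStrip F ε) {δ : ℝ} (hδ : 0 < δ) :
    DecaysInStrip (deriv F) (ε - δ) where
  differentiableOn := (hF.differentiableOn.deriv (isOpen_abs_im_lt ε)).mono
    fun z (hz : |z.im| < ε - δ) => show |z.im| < ε by linarith
  exists_norm_le a := by
    obtain ⟨c, C, hc, hC₀, hC⟩ := hF.exists_norm_le (a - δ)
    refine ⟨c, C * Real.exp (c * δ) / δ, hc, by positivity, fun z hz ha => ?_⟩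
    have h_ball (w : ℂ) (hw : w ∈ Metric.closedBall z δ) : |w.im| < ε ∧ z.re - δ ≤ w.re := by
      rw [mem_closedBall_iff_norm] at hw
      have him : |w.im - z.im| ≤ δ := (Complex.abs_im_le_norm (w - z)).trans hw
      have hre : |w.re - z.re| ≤ δ := (Complex.abs_re_le_norm (w - z)).trans hw
      exact ⟨by linarith [abs_sub_abs_le_abs_sub w.im z.im], by linarith [neg_le_of_abs_le hre]⟩
    calc ‖deriv F z‖ ≤ C * Real.exp (-c * (z.re - δ)) / δ := by
          refine Complex.norm_deriv_le_of_forall_mem_sphere_norm_le hδ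
            (hF.differentiableOn.diffContOnCl_ball fun w hw => (h_ball w hw).1) fun w hw => ?_
          obtain ⟨him, hre⟩ := h_ball w (Metric.sphere_subset_closedBall hw)
          refine (hC w him (by linarith)).trans ?_
          gcongr C * Real.exp ?_
          nlinarith
      _ = C * Real.exp (c * δ) / δ * Real.exp (-c * z.re) := by
          rw [div_mul_eq_mul_div, mul_assoc, ← Real.exp_add]
          ring_nf

theorem isDecaying_re (hF : DecaysInStrip F ε) (hε : 0 < ε) :
    IsDecaying fun x : ℝ => (F x).re where
  continuous := Complex.continuous_re.comp
    (hF.differentiableOn.continuousOn.comp_continuous Complex.continuous_ofReal (by simpa using hε))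
  expDecay := by
    obtain ⟨c, C, hc, -, hC⟩ := hF.exists_norm_le 0
    refine ⟨c, hc, IsBigO.of_bound C ?_⟩
    filter_upwards [eventually_ge_atTop 0] with x hx
    rw [norm_norm, Real.norm_eq_abs, Real.norm_eq_abs, Real.abs_exp]
    exact (Complex.abs_re_le_norm _).trans (hC x (by simpa using hε) hx)

theorem isDecayingC1_re (hF : DecaysInStrip F ε) (hε : 0 < ε) :
    IsDecayingC1 fun x : ℝ => (F x).re := by
  have hderiv (x : ℝ) : HasDerivAt (fun x : ℝ => (F x).re) (deriv F x).re x :=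
    (hF.hasDerivAt (by simpa using hε)).real_of_complex
  refine ⟨fun x => (hderiv x).differentiableAt, (hF.isDecaying_re hε).expDecay, ?_⟩
  rw [funext fun x => (hderiv x).deriv]
  exact (hF.deriv (half_pos hε)).isDecaying_re (by linarith)

theorem exists_memLp_norm_translate_le (hF : DecaysInStrip F ε) (a : ℝ) :
    ∃ bound : ℝ → ℝ, MemLp bound 2 halfLine ∧
      ∀ᵐ x : ℝ ∂halfLine, ∀ z : ℂ, |z.im| < ε → a ≤ z.re → ‖F (x + z)‖ ≤ bound x := by
  obtain ⟨c, C, hc, hC₀, hC⟩ := hF.exists_norm_le a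
  obtain ⟨bound, hbound, hle⟩ := exists_memLp_exp_neg_mul_le hc hC₀ a
  refine ⟨bound, hbound, ?_⟩
  filter_upwards [ae_restrict_mem measurableSet_Ioi] with x (hx : 0 < x) z hz ha
  have h := hC (x + z) (by simpa using hz) (by simp; linarith)
  rw [Complex.add_re, Complex.ofReal_re] at h
  exact h.trans (hle x z.re ha)

theorem aestronglyMeasurable_mul (hF : DecaysInStrip F ε) {z : ℂ} (hz : |z.im| < ε) (f : L2) :
    AEStronglyMeasurable (fun x : ℝ => F (x + z) * f x) halfLine :=
  (hF.differentiableOn.continuousOn.comp_continuous (by fun_prop)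
    (by simpa using hz)).aestronglyMeasurable.mul
    (Complex.continuous_ofReal.comp_aestronglyMeasurable (Lp.aestronglyMeasurable f))

theorem differentiableOn_integral_mul (hF : DecaysInStrip F ε) (f : L2) :
    DifferentiableOn ℂ (fun z => ∫ x : ℝ, F (x + z) * f x ∂halfLine) {z | |z.im| < ε} := by
  intro z₀ (hz₀ : |z₀.im| < ε)
  obtain ⟨δ, hδ, hδε⟩ := exists_between (sub_pos.2 hz₀)
  have hF' := hF.deriv hδ
  obtain ⟨bound, hbound, hle⟩ := hF.exists_memLp_norm_translate_le z₀.re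
  obtain ⟨bound', hbound', hle'⟩ := hF'.exists_memLp_norm_translate_le (z₀.re - 1)
  have hz₀δ : |z₀.im| < ε - δ := by linarith
  have hS : {z : ℂ | |z.im| < ε - δ ∧ z₀.re - 1 < z.re} ∈ 𝓝 z₀ :=
    ((isOpen_abs_im_lt _).inter (isOpen_lt continuous_const Complex.continuous_re)).mem_nhds
      ⟨hz₀δ, sub_one_lt z₀.re⟩
  have hlt {z : ℂ} (hz : |z.im| < ε - δ) : |z.im| < ε := by linarith
  refine (hasDerivAt_integral_of_dominated_loc_of_deriv_le hS
    (F' := fun z x => deriv F (x + z) * f x) (bound := fun x => bound' x * ‖f x‖)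
    ?_ ?_ (hF'.aestronglyMeasurable_mul hz₀δ f) ?_
    (hbound'.integrable_mul (Lp.memLp f).norm) ?_).2.differentiableAt.differentiableWithinAt
  · exact eventually_of_mem hS fun z hz => hF.aestronglyMeasurable_mul (hlt hz.1) f
  · refine (hbound.integrable_mul (Lp.memLp f).norm).mono' (hF.aestronglyMeasurable_mul hz₀ f) ?_
    filter_upwards [hle] with x hx
    rw [norm_mul, Complex.norm_real]
    exact mul_le_mul_of_nonneg_right (hx z₀ hz₀ le_rfl) (norm_nonneg _)
  · filter_upwards [hle'] with x hx z hz
    rw [norm_mul, Complex.norm_real]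
    exact mul_le_mul_of_nonneg_right (hx z hz.1 hz.2.le) (norm_nonneg _)
  · refine Eventually.of_forall fun x z hz => HasDerivAt.mul_const ?_ _
    exact (hF.hasDerivAt (by simpa using hlt hz.1)).comp_const_add (x : ℂ) z

end DecaysInStrip

namespace AnalyticInStrip

variable {A : ℝ → ℝ}

theorem isDecayingC1 (hA : AnalyticInStrip A) : IsDecayingC1 A := by
  obtain ⟨F, ε, hε, hF, hFA⟩ := hA.exists_decaysInStrip
  simpa only [hFA, Complex.ofReal_re] using hF.isDecayingC1_re hε

theorem analyticOnNhd_inner_translate (hA : AnalyticInStrip A) (f : L2) :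
    AnalyticOnNhd ℝ (fun r => inner ℝ f (translate A r)) Set.univ := by
  obtain ⟨F, ε, hε, hF, hFA⟩ := hA.exists_decaysInStrip
  have hG := hF.differentiableOn_integral_mul f |>.analyticOnNhd (isOpen_abs_im_lt ε)
  have hinner (r : ℝ) : inner ℝ f (translate A r) =
      (∫ x : ℝ, F (x + r) * f x ∂halfLine).re := by
    have hreal : ∫ x : ℝ, F (x + r) * f x ∂halfLine =
        ((∫ x, A (x + r) * f x ∂halfLine : ℝ) : ℂ) := by
      rw [← integral_complex_ofReal]
      refine integral_congr_ae (Eventually.of_forall fun x => ?_)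
      simp only [← Complex.ofReal_add, hFA, Complex.ofReal_mul]
    rw [hreal, Complex.ofReal_re, real_inner_comm, inner_eq_integral_mul]
    refine integral_congr_ae ?_
    filter_upwards [hA.isDecayingC1.isDecaying.coeFn_translate r] with x hx
    rw [hx]
  intro r _
  rw [funext hinner]
  exact (hG r (by simpa using hε)).re_ofReal

end AnalyticInStrip

end Strip

section Orthogonality

/-- The subspace of `L²(ℝ₊)` of smooth functions with compact support in `(0, ∞)`. -/
def testFunctions : Submodule ℝ L2 where
  carrier := {f | ∃ φ : ℝ → ℝ, ContDiff ℝ ∞ φ ∧ HasCompactSupport φ ∧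
    tsupport φ ⊆ Set.Ioi 0 ∧ f =ᵐ[halfLine] φ}
  zero_mem' := ⟨0, contDiff_const, HasCompactSupport.zero, by simp, Lp.coeFn_zero _ _ _⟩
  add_mem' := by
    rintro f g ⟨φ, hφ, hφc, hφs, hfφ⟩ ⟨ψ, hψ, hψc, hψs, hgψ⟩
    exact ⟨φ + ψ, hφ.add hψ, hφc.add hψc, (tsupport_add φ ψ).trans (Set.union_subset hφs hψs),
      (Lp.coeFn_add f g).trans (hfφ.add hgψ)⟩
  smul_mem' := by
    rintro c f ⟨φ, hφ, hφc, hφs, hfφ⟩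
    exact ⟨c • φ, hφ.const_smul c, hφc.smul_left,
      (tsupport_smul_subset_right (fun _ => c) φ).trans hφs,
      (Lp.coeFn_smul c f).trans (hfφ.const_smul c)⟩

theorem integral_halfLine_mul_eq {f φ : ℝ → ℝ} (hφ : tsupport φ ⊆ Set.Ioi 0)
    (hf : f =ᵐ[halfLine] φ) (g : ℝ → ℝ) :
    ∫ x, g x * f x ∂halfLine = ∫ x, g x * φ x := by
  rw [← setIntegral_eq_integral_of_forall_compl_eq_zero (s := Set.Ioi (0 : ℝ))
    (f := fun x => g x * φ x) fun x hx => by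
      rw [image_eq_zero_of_notMem_tsupport fun h => hx (hφ h), mul_zero]]
  exact integral_congr_ae (hf.mono fun x hx => by simp only [hx])

theorem dense_testFunctions : Dense (testFunctions : Set L2) := by
  rw [Submodule.dense_iff_topologicalClosure_eq_top, Submodule.topologicalClosure_eq_top_iff,
    Submodule.eq_bot_iff]
  intro f hf
  have hloc : LocallyIntegrableOn f (Set.Ioi (0 : ℝ)) volume :=
    locallyIntegrableOn_of_locallyIntegrable_restrict
      ((Lp.memLp f).locallyIntegrable (by norm_num))
  have hzero : ∀ᵐ x : ℝ, x ∈ Set.Ioi (0 : ℝ) → f x = 0 := by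
    refine isOpen_Ioi.ae_eq_zero_of_integral_contDiff_smul_eq_zero hloc fun φ hφ hφc hφs => ?_
    have hφ₂ : MemLp φ 2 halfLine := hφ.continuous.memLp_of_hasCompactSupport hφc
    have h := (Submodule.mem_orthogonal' _ _).1 hf (hφ₂.toLp φ) ⟨φ, hφ, hφc, hφs, hφ₂.coeFn_toLp⟩
    rw [inner_eq_integral_mul, integral_halfLine_mul_eq hφs hφ₂.coeFn_toLp] at h
    simpa only [smul_eq_mul, mul_comm] using h
  refine Lp.ext ?_
  filter_upwards [(ae_restrict_iff' measurableSet_Ioi).2 hzero, Lp.coeFn_zero ℝ 2 halfLine]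
    with x hx h₀
  rw [hx, h₀, Pi.zero_apply]

theorem Orthogonality.integral_sq {A φ : ℝ → ℝ} (ho : Orthogonality A) (hφ : ContDiff ℝ ∞ φ)
    (hφc : HasCompactSupport φ) :
    Integrable (fun r => (∫ x, A (x + r) * φ x) ^ 2) ∧
      ∫ r, (∫ x, A (x + r) * φ x) ^ 2 = ∫ x, φ x * φ x := by
  simpa only [sq, add_comm] using ho φ φ hφ hφc hφ hφc

theorem Orthogonality.norm_opA_le {A : ℝ → ℝ} (ho : Orthogonality A) (hA : IsDecaying A) (t : ℝ)
    (f : L2) : ‖opA A t f‖ ≤ ‖f‖ := by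
  refine dense_testFunctions.induction (P := fun f => ‖opA A t f‖ ≤ ‖f‖) ?_
    (isClosed_le (by fun_prop) (by fun_prop)) f
  rintro f ⟨φ, hφ, hφc, hφs, hfφ⟩
  obtain ⟨hint, hsq⟩ := ho.integral_sq hφ hφc
  have hop : opA A t f =ᵐ[halfLine] fun r => ∫ x, A (x + (r + t)) * φ x := by
    filter_upwards [hA.hasKernel_opA t f] with r hr
    rw [hr.2, integral_halfLine_mul_eq hφs hfφ]
    simp only [add_left_comm r, add_assoc]
  refine le_of_sq_le_sq ?_ (norm_nonneg f)
  rw [← real_inner_self_eq_norm_sq, ← real_inner_self_eq_norm_sq]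
  calc inner ℝ (opA A t f) (opA A t f)
      = ∫ r, (∫ x, A (x + (r + t)) * φ x) ^ 2 ∂halfLine := by
        rw [inner_eq_integral_mul]
        exact integral_congr_ae (hop.mono fun r hr => by simp only [hr, sq])
    _ ≤ ∫ r, (∫ x, A (x + (r + t)) * φ x) ^ 2 :=
        setIntegral_le_integral (hint.comp_add_right t) (Eventually.of_forall fun r => sq_nonneg _)
    _ = ∫ x, φ x * φ x := by
        rw [integral_add_right_eq_self fun r => (∫ x, A (x + r) * φ x) ^ 2, hsq]
    _ = inner ℝ f f := by
        rw [inner_eq_integral_mul, ← integral_halfLine_mul_eq hφs hfφ]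
        exact integral_congr_ae (hfφ.mono fun x hx => by simp only [hx])

end Orthogonality

section Invertibility

variable {A : ℝ → ℝ}

theorem IsDecayingC1.hasDerivAt_norm_opA_sq (hA : IsDecayingC1 A) (f : L2) (t : ℝ) :
    HasDerivAt (fun t => ‖opA A t f‖ ^ 2) (-inner ℝ f (translate A t) ^ 2) t := by
  have hnorm (t : ℝ) : ‖opA A t f‖ ^ 2 = inner ℝ f (opK A t f) := by
    rw [← real_inner_self_eq_norm_sq, hA.isDecaying.inner_opA_comm, opK, sq, mul_apply_eq_comp]
  rw [funext hnorm]
  refine (((innerSL ℝ f).hasFDerivAt).comp_hasDerivAt t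
    ((hA.hasDerivAt_opK t).clm_apply (hasDerivAt_const t f))).congr_deriv ?_
  rw [map_zero, add_zero, innerSL_apply_apply, neg_apply, InnerProductSpace.rankOne_apply,
    inner_neg_right, real_inner_smul_right, real_inner_comm, sq]

theorem eq_zero_of_opA_opA_eq_self (ho : Orthogonality A) (hA : AnalyticInStrip A) {s : ℝ} {f : L2}
    (hf : opA A s (opA A s f) = f) : f = 0 := by
  have hderiv := hA.isDecayingC1.hasDerivAt_norm_opA_sq f
  have hanti : Antitone fun t => ‖opA A t f‖ ^ 2 :=
    antitone_of_hasDerivAt_nonpos hderiv fun t => neg_nonpos.2 (sq_nonneg _)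
  have hnorm : ‖opA A s f‖ = ‖f‖ :=
    (ho.norm_opA_le hA.isDecayingC1.isDecaying s f).antisymm
      (by simpa only [hf] using ho.norm_opA_le hA.isDecayingC1.isDecaying s (opA A s f))
  have hconst (t : ℝ) (ht : t < s) : ‖opA A t f‖ ^ 2 = ‖f‖ ^ 2 := by
    refine le_antisymm ?_ (hnorm ▸ hanti ht.le)
    gcongr
    exact ho.norm_opA_le hA.isDecayingC1.isDecaying t f
  have horth (t : ℝ) (ht : t < s) : inner ℝ f (translate A t) = 0 := by
    have h := (hderiv t).unique ((hasDerivAt_const t (‖f‖ ^ 2)).congr_of_eventuallyEq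
      ((eventually_lt_nhds ht).mono hconst))
    simpa using h
  have hinner : (fun t => inner ℝ f (translate A t)) = fun _ => 0 :=
    (hA.analyticOnNhd_inner_translate f).eq_of_eventuallyEq analyticOnNhd_const
      ((eventually_lt_nhds (sub_one_lt s)).mono horth)
  have hop : opA A s f = 0 := by
    refine Lp.ext ?_
    rw [hA.isDecayingC1.isDecaying.opA_apply]
    filter_upwards [(hA.isDecayingC1.isDecaying.isDecaying_inner_translate f).coeFn_translate s,
      Lp.coeFn_zero ℝ 2 halfLine] with x hx h₀
    rw [hx, h₀, congrFun hinner, Pi.zero_apply]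
  rw [← hf, hop, map_zero]

theorem isUnit_one_sub_opK (ho : Orthogonality A) (hA : AnalyticInStrip A) (s : ℝ) :
    IsUnit (1 - opK A s) := by
  have hcomp : IsCompactOperator (opK A s) := by
    rw [opK, sq]
    exact (hA.isDecayingC1.isDecaying.isCompactOperator_opA s).comp_clm (opA A s)
  refine (hcomp.hasEigenvalue_or_mem_resolventSet one_ne_zero).elim (fun h => ?_) fun h => ?_
  · obtain ⟨f, hf⟩ := h.exists_hasEigenvector
    exact absurd (eq_zero_of_opA_opA_eq_self ho hA (by simpa [opK, sq] using hf.apply_eq_smul)) hf.2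
  · simpa [spectrum.mem_resolventSet_iff] using h

end Invertibility

section SmoothKernel

theorem isDecayingC1_iteratedDeriv {A : ℝ → ℝ} {k : ℕ} (hA : ContDiff ℝ (k + 1) A)
    (hk : ExpDecay (iteratedDeriv k A)) (hk' : ExpDecay (iteratedDeriv (k + 1) A)) :
    IsDecayingC1 (iteratedDeriv k A) where
  differentiable := hA.differentiable_iteratedDeriv k (by exact_mod_cast k.lt_succ_self)
  expDecay := hk.norm
  isDecaying_deriv := by
    rw [← iteratedDeriv_succ]
    exact ⟨hA.continuous_iteratedDeriv (k + 1) (by norm_cast), hk'.norm⟩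

end SmoothKernel

end

end HankelHierarchy

open HankelHierarchy in
theorem mainTheorem1_general (A : ℝ → ℝ) :
    (Orthogonality A → AnalyticInStrip A → ∀ s : ℝ, IsUnit (1 - opK A s)) ∧
    ∀ p : ℕ, ContDiff ℝ (p + 1) A → (∀ k ≤ p + 1, ExpDecay (iteratedDeriv k A)) →
      ∀ s : ℝ, IsUnit (1 - opK A s) →
        HasDerivAt (q A p) (q A (p + 1) s - q A 0 s * u A p s) s ∧
        HasDerivAt (u A p) (-(q A 0 s * q A p s)) s := by
  refine ⟨isUnit_one_sub_opK, fun p hA hdecay s hs => ?_⟩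
  have h₀ : IsDecayingC1 A := isDecayingC1_iteratedDeriv (k := 0)
    (hA.of_le (by norm_cast; lia)) (hdecay 0 (by lia)) (hdecay (0 + 1) (by lia))
  have hp : IsDecayingC1 (iteratedDeriv p A) :=
    isDecayingC1_iteratedDeriv hA (hdecay p (by lia)) (hdecay (p + 1) le_rfl)
  simp only [q_eq_qWith, u_eq_uWith, iteratedDeriv_succ, iteratedDeriv_zero]
  exact ⟨h₀.hasDerivAt_qWith hp hs, h₀.hasDerivAt_uWith hp hs⟩

theorem mainTheorem1 (A : ℝ → ℝ) (hA : ContDiff ℝ ∞ A)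
    (hdecay : ∀ p : ℕ, HankelHierarchy.ExpDecay (iteratedDeriv p A)) :
    -- In the setting of an orthogonal analytic `A`, the resolvent exists for every `s`.
    (HankelHierarchy.Orthogonality A → HankelHierarchy.AnalyticInStrip A →
      ∀ s : ℝ, IsUnit (1 - HankelHierarchy.opK A s)) ∧
    -- The hierarchy holds at every `s` at which `I - K_s` is invertible.
    ∀ s : ℝ, IsUnit (1 - HankelHierarchy.opK A s) → ∀ p : ℕ,
      HasDerivAt (HankelHierarchy.q A p)
        (HankelHierarchy.q A (p + 1) s - HankelHierarchy.q A 0 s * HankelHierarchy.u A p s) s ∧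
      HasDerivAt (HankelHierarchy.u A p)
        (-(HankelHierarchy.q A 0 s * HankelHierarchy.q A p s)) s :=
  ⟨(mainTheorem1_general A).1, fun s hs p => (mainTheorem1_general A).2 p
    (hA.of_le (by exact_mod_cast le_top)) (fun k _ => hdecay k) s hs⟩
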